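/- Let $d, p \ge 0$ be integers with $p \ge d$, and let $\mathcal{M} \subset \mathbb{R}^p$ be a nonempty compact connected $d$-dimensional smooth ($C^\infty$) embedded submanifold without boundary, that is, $\mathcal{M}$ with its subspace topology carries the structure of a smooth $d$-dimensional manifold for which the inclusion $\mathcal{M} \hookrightarrow \mathbb{R}^p$ is a smooth embedding (an immersion that is a homeomorphism onto its image). Then there exists a smooth map $$f : \mathbb{S}^d \to \mathbb{R}^p, \qquad \mathbb{S}^d = \{x \in \mathbb{R}^{d+1} : \|x\|_2 = 1\},$$ such that $f(\mathbb{S}^d) = \mathcal{M}$. -/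

import Mathlib

open scoped Manifold ContDiff

section SmoothParametrization

variable {E F : Type*} [NormedAddCommGroup E] [InnerProductSpace ℝ E]
  [NormedAddCommGroup F] [NormedSpace ℝ F]

/-! It suffices to cover `M` by a smooth map `ℝ^d → M` that is constant outside a ball: rescaled, it
pulls back to `S^d` along the projection onto a coordinate hyperplane. Charts cut off by bump
functions give such maps locally. Two with the same outer value are glued by moving their active
balls apart (`CoveredFrom.union`). The outer value is changed by adding a collar that runs along a
path (`CoveredFrom.of_path`). Connectedness makes all outer values interchangeable, and compactness
leaves finitely many gluings. -/

/-- `q` is a smooth path in `M` from `b` to `c`, constant outside the unit interval. -/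
structure IsSmoothPathIn (M : Set F) (b c : F) (q : ℝ → F) : Prop where
  contDiff : ContDiff ℝ ∞ q
  mem : ∀ t, q t ∈ M
  eq_source : ∀ t ≤ 0, q t = b
  eq_target : ∀ t, 1 ≤ t → q t = c

lemma IsSmoothPathIn.reverse {M : Set F} {b c : F} {q : ℝ → F} (hq : IsSmoothPathIn M b c q) :
    IsSmoothPathIn M c b fun t ↦ q (1 - t) where
  contDiff := hq.contDiff.comp (contDiff_const.sub contDiff_id)
  mem t := hq.mem _
  eq_source t ht := hq.eq_target _ (by linarith)
  eq_target t ht := hq.eq_source _ (by linarith)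

variable (E) in
/-- Some smooth map `E → F` with values in `M`, equal to `b` outside a ball, covers `K`. -/
def CoveredFrom (M : Set F) (b : F) (K : Set F) : Prop :=
  ∃ h : E → F, ContDiff ℝ ∞ h ∧ (∀ x, h x ∈ M) ∧ K ⊆ Set.range h ∧
    ∃ R : ℝ, 0 ≤ R ∧ ∀ x, R ≤ ‖x‖ → h x = b

lemma CoveredFrom.mono {M : Set F} {b : F} {K L : Set F} (hL : CoveredFrom E M b L)
    (hKL : K ⊆ L) : CoveredFrom E M b K := by
  obtain ⟨h, hs, hM, hr, hR⟩ := hL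
  exact ⟨h, hs, hM, hKL.trans hr, hR⟩

lemma coveredFrom_empty {M : Set F} {b : F} (hb : b ∈ M) : CoveredFrom E M b ∅ :=
  ⟨fun _ ↦ b, contDiff_const, fun _ ↦ hb, Set.empty_subset _, 0, le_rfl, fun _ _ ↦ rfl⟩

/-- Translating `h₂` by a vector of norm `R₁ + R₂` makes the supports of the two deviations from `b`
disjoint. So `h₁ x + h₂ (x - a) - b` is at each point a value of one of the two maps, and stays in
`M` although `M` is not linear. -/
lemma CoveredFrom.union [Nontrivial E] {M : Set F} {b : F} {K L : Set F}
    (hK : CoveredFrom E M b K) (hL : CoveredFrom E M b L) : CoveredFrom E M b (K ∪ L) := by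
  obtain ⟨h₁, hs₁, hM₁, hr₁, R₁, hR₁, hb₁⟩ := hK
  obtain ⟨h₂, hs₂, hM₂, hr₂, R₂, hR₂, hb₂⟩ := hL
  have h0 : 0 ≤ R₁ + R₂ := add_nonneg hR₁ hR₂
  obtain ⟨a, ha⟩ := exists_norm_eq E h0
  have far : ∀ x, h₁ x = b ∨ h₂ (x - a) = b := by
    intro x
    rcases le_or_gt R₁ ‖x‖ with hx | hx
    · exact .inl (hb₁ x hx)
    · refine .inr (hb₂ _ ?_)
      have := norm_sub_norm_le a x
      rw [norm_sub_rev] at this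
      linarith
  -- `a + a` lies outside both active balls, so the value `b` is not lost.
  have hend : h₁ (a + a) + h₂ (a + a - a) - b = b := by
    rw [hb₁, hb₂, add_sub_cancel_right]
    · rw [add_sub_cancel_right]; linarith
    · rw [← two_smul ℝ a, norm_smul, ha]; norm_num; linarith
  refine ⟨fun x ↦ h₁ x + h₂ (x - a) - b, ?_, ?_, ?_, R₁ + R₂ + R₂, by linarith, ?_⟩
  · exact (hs₁.add (hs₂.comp (contDiff_id.sub contDiff_const))).sub contDiff_const
  · intro x
    rcases far x with hx | hx
    · simpa [hx] using hM₂ (x - a)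
    · simpa [hx] using hM₁ x
  · rintro k (hk | hk)
    · obtain ⟨x, rfl⟩ := hr₁ hk
      rcases far x with hx | hx
      · exact ⟨a + a, by simp only [hend, hx]⟩
      · exact ⟨x, by simp [hx]⟩
    · obtain ⟨y, rfl⟩ := hr₂ hk
      rcases far (y + a) with hx | hx
      · exact ⟨y + a, by simp [hx]⟩
      · rw [add_sub_cancel_right] at hx
        exact ⟨a + a, by simp only [hend, hx]⟩
  · intro x hx
    have := norm_sub_norm_le x a
    simp only
    rw [hb₁ x (by linarith), hb₂ (x - a) (by linarith), add_sub_cancel_right]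

/-- The map travels radially along `q` in the collar `R ≤ ‖x‖ ≤ R + 1`. The squared norm keeps the
parameter smooth at the origin, and `(R + 1)² - R² ≥ 1` makes it reach the end of the path. -/
lemma CoveredFrom.of_path [Nontrivial E] {M : Set F} {b c : F} {K : Set F} {q : ℝ → F}
    (hK : CoveredFrom E M b K) (hq : IsSmoothPathIn M b c q) : CoveredFrom E M c K := by
  obtain ⟨h, hs, hM, hr, R, hR, hb⟩ := hK
  have near : ∀ x : E, ‖x‖ ≤ R → q (‖x‖ ^ 2 - R ^ 2) = b := fun x hx ↦
    hq.eq_source _ (by nlinarith [norm_nonneg x])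
  refine ⟨fun x ↦ h x + q (‖x‖ ^ 2 - R ^ 2) - b, ?_, ?_, ?_, R + 1, by linarith, ?_⟩
  · exact (hs.add (hq.contDiff.comp ((contDiff_norm_sq ℝ).sub contDiff_const))).sub contDiff_const
  · intro x
    rcases le_total ‖x‖ R with hx | hx
    · simpa [near x hx] using hM x
    · simpa [hb x hx] using hq.mem _
  · intro k hk
    obtain ⟨x, rfl⟩ := hr hk
    rcases le_total ‖x‖ R with hx | hx
    · exact ⟨x, by simp [near x hx]⟩
    -- On the sphere of radius `R` the path has not yet left `b`.
    · obtain ⟨y, hy⟩ := exists_norm_eq E hR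
      exact ⟨y, by simp [near y hy.le, hb x hx, hb y hy.ge]⟩
  · intro x hx
    simp only
    rw [hb x (by linarith), hq.eq_target _ (by nlinarith), add_sub_cancel_left]

lemma exists_isSmoothPathIn_of_contDiff {M : Set F} {ψ : E → F} (hψ : ContDiff ℝ ∞ ψ)
    (hM : ∀ x, ψ x ∈ M) (v : E) : ∃ q, IsSmoothPathIn M (ψ 0) (ψ v) q :=
  ⟨fun t ↦ ψ (Real.smoothTransition t • v),
    hψ.comp (Real.smoothTransition.contDiff.smul contDiff_const), fun _ ↦ hM _,
    fun t ht ↦ by simp [Real.smoothTransition.zero_of_nonpos ht],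
    fun t ht ↦ by simp [Real.smoothTransition.one_of_one_le ht]⟩

/-- If every point of a compact connected set `M` has a neighborhood in `M` covered by a smooth
map `E → M` that is constant outside a ball, then `M` is the image of such a map. -/
lemma CoveredFrom.of_isCompact_of_isConnected [Nontrivial E] {M : Set F} (hcompact : IsCompact M)
    (hconn : IsConnected M)
    (hloc : ∀ b ∈ M, ∃ ψ : E → F, ContDiff ℝ ∞ ψ ∧ (∀ x, ψ x ∈ M) ∧ ψ 0 = b ∧
      Set.range ψ ∈ nhdsWithin b M ∧ ∃ R : ℝ, 0 ≤ R ∧ ∀ x, R ≤ ‖x‖ → ψ x = b) :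
    ∃ b, CoveredFrom E M b M := by
  obtain ⟨b₀, hb₀⟩ := hconn.nonempty
  refine ⟨b₀, ?_⟩
  -- Independence of the outer value holds locally, by paths inside the range of `ψ`, hence globally
  -- by connectedness.
  have key : ∀ b ∈ M, ∀ c ∈ M, ∀ K, CoveredFrom E M b K ↔ CoveredFrom E M c K := by
    intro b hb c hc
    refine hconn.isPreconnected.induction₂
      (fun b c ↦ ∀ K, CoveredFrom E M b K ↔ CoveredFrom E M c K) ?_
      (fun x y z _ _ _ h h' K ↦ (h K).trans (h' K)) (fun x y _ _ h K ↦ (h K).symm) hb hc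
    intro x hx
    obtain ⟨ψ, hψ, hM, rfl, hn, -⟩ := hloc x hx
    filter_upwards [hn]
    rintro _ ⟨v, rfl⟩ K
    obtain ⟨q, hq⟩ := exists_isSmoothPathIn_of_contDiff hψ hM v
    exact ⟨fun h ↦ h.of_path hq, fun h ↦ h.of_path hq.reverse⟩
  refine hcompact.induction_on (p := CoveredFrom E M b₀) (coveredFrom_empty hb₀) (fun s t hst ht ↦ ht.mono hst)
    (fun s t hs ht ↦ hs.union ht) fun x hx ↦ ?_
  obtain ⟨ψ, hψ, hM, -, hn, hR⟩ := hloc x hx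
  exact ⟨_, hn, (key b₀ hb₀ x hx _).2 ⟨ψ, hψ, hM, subset_rfl, hR⟩⟩

end SmoothParametrization

/-- Around each point of a smooth manifold `M ⊆ F`, a chart cut off by a bump function gives a
smooth map `E → F` with values in `M` that covers a neighborhood of the point. -/
lemma exists_contDiff_range_mem_nhdsWithin {E F : Type*} [NormedAddCommGroup E]
    [InnerProductSpace ℝ E] [FiniteDimensional ℝ E] [NormedAddCommGroup F] [NormedSpace ℝ F]
    {M : Set F} [ChartedSpace E M] [IsManifold 𝓘(ℝ, E) ∞ M]
    (hval : ContMDiff 𝓘(ℝ, E) 𝓘(ℝ, F) ∞ (Subtype.val : M → F)) {b : F} (hb : b ∈ M) :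
    ∃ ψ : E → F, ContDiff ℝ ∞ ψ ∧ (∀ x, ψ x ∈ M) ∧ ψ 0 = b ∧
      Set.range ψ ∈ nhdsWithin b M ∧ ∃ R : ℝ, 0 ≤ R ∧ ∀ x, R ≤ ‖x‖ → ψ x = b := by
  set e := chartAt E (⟨b, hb⟩ : M)
  have hbs : (⟨b, hb⟩ : M) ∈ e.source := mem_chart_source E _
  set c := e ⟨b, hb⟩ with hc
  obtain ⟨r, hr, hball⟩ := Metric.isOpen_iff.1 e.open_target c (e.map_source hbs)
  let f : ContDiffBump (0 : E) := ⟨r / 2, r, by positivity, by linarith⟩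
  -- The cutoff keeps the argument within `r` of `c`, yet is the plain translation on the ball of
  -- radius `r / 2`.
  have hf : ∀ x, c + f x • x ∈ e.target := by
    intro x
    apply hball
    rw [Metric.mem_ball, dist_eq_norm, add_sub_cancel_left, norm_smul, Real.norm_of_nonneg f.nonneg]
    rcases lt_or_ge ‖x‖ r with hx | hx
    · nlinarith [norm_nonneg x, f.le_one (x := x)]
    · rw [f.zero_of_le_dist (by simpa using hx), zero_mul]; exact hr
  have hc0 : e.symm c = ⟨b, hb⟩ := e.left_inv hbs
  refine ⟨fun x ↦ (e.symm (c + f x • x) : M), ?_, fun x ↦ Subtype.coe_prop _, by simp [hc0], ?_,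
    r, hr.le, ?_⟩
  · rw [← contMDiff_iff_contDiff]
    refine hval.comp ?_
    have h1 : ContMDiff 𝓘(ℝ, E) 𝓘(ℝ, E) ∞ fun x ↦ c + f x • x :=
      contMDiff_iff_contDiff.2 (contDiff_const.add (f.contDiff.smul contDiff_id))
    exact (contMDiffOn_chart_symm (I := 𝓘(ℝ, E)) (n := ∞)).comp_contMDiff h1 hf
  · rw [← preimage_coe_mem_nhds_subtype (a := ⟨b, hb⟩)]
    filter_upwards [e.open_source.mem_nhds hbs,
      (e.continuousAt hbs).preimage_mem_nhds (Metric.closedBall_mem_nhds c (half_pos hr))]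
      with y hy hyc
    have hfy : f (e y - c) = 1 := f.one_of_mem_closedBall (by
      rw [mem_closedBall_zero_iff, ← dist_eq_norm]; exact hyc)
    exact ⟨e y - c, by simp [hfy, e.left_inv hy]⟩
  · intro x hx
    simp [f.zero_of_le_dist (show f.rOut ≤ dist x 0 by simpa using hx), hc0]

/-- A map out of `ℝ^d` that is constant outside a ball factors, up to its range, through the
projection of the sphere `S^d` to a coordinate hyperplane. -/
lemma exists_contMDiff_sphere_range_eq {F : Type*} [NormedAddCommGroup F] [NormedSpace ℝ F]
    {d : ℕ} [NeZero d] {h : EuclideanSpace ℝ (Fin d) → F} (hs : ContDiff ℝ ∞ h) {R : ℝ} {b : F}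
    (hb : ∀ x, R ≤ ‖x‖ → h x = b) :
    ∃ f : Metric.sphere (0 : EuclideanSpace ℝ (Fin (d + 1))) 1 → F,
      ContMDiff (𝓡 d) 𝓘(ℝ, F) ∞ f ∧ Set.range f = Set.range h := by
  let π : EuclideanSpace ℝ (Fin (d + 1)) → EuclideanSpace ℝ (Fin d) :=
    fun x ↦ WithLp.toLp 2 fun i ↦ x i.succ
  have hπ : ContDiff ℝ ∞ π := by
    rw [contDiff_euclidean]
    intro i
    exact contDiff_euclidean.1 contDiff_id i.succ
  set r := max R 1
  have hr : 0 < r := lt_max_of_lt_right one_pos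
  have hball : ∀ z : EuclideanSpace ℝ (Fin d), ‖z‖ ≤ r →
      ∃ y : Metric.sphere (0 : EuclideanSpace ℝ (Fin (d + 1))) 1, r • π y = z := by
    intro z hz
    have hw : ‖r⁻¹ • z‖ ≤ 1 := by
      rw [norm_smul, norm_inv, Real.norm_of_nonneg hr.le]
      exact (inv_mul_le_one₀ hr).2 hz
    -- Lift to the hemisphere where the dropped coordinate is nonnegative.
    refine ⟨⟨WithLp.toLp 2 (Fin.cons (√(1 - ‖r⁻¹ • z‖ ^ 2)) fun i ↦ (r⁻¹ • z) i), ?_⟩, ?_⟩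
    · rw [mem_sphere_zero_iff_norm, EuclideanSpace.norm_eq, Real.sqrt_eq_one, Fin.sum_univ_succ]
      simp only [Fin.cons_zero, Fin.cons_succ]
      rw [← EuclideanSpace.norm_sq_eq, Real.norm_of_nonneg (Real.sqrt_nonneg _),
        Real.sq_sqrt (by nlinarith [norm_nonneg (r⁻¹ • z)])]
      ring
    · ext i
      simp [π, hr.ne']
  refine ⟨fun y ↦ h (r • π y), ?_, ?_⟩
  · have := Fact.mk (finrank_euclideanSpace_fin (𝕜 := ℝ) (n := d + 1))
    have hg : ContDiff ℝ ∞ fun x ↦ h (r • π x) := hs.comp (hπ.const_smul r)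
    exact (contMDiff_iff_contDiff.2 hg).comp (contMDiff_coe_sphere (n := d))
  · refine (Set.range_comp_subset_range _ h).antisymm ?_
    rintro _ ⟨z, rfl⟩
    rcases le_total ‖z‖ r with hz | hz
    · obtain ⟨y, hy⟩ := hball z hz
      exact ⟨y, congrArg h hy⟩
    · obtain ⟨w, hw⟩ := exists_norm_eq (EuclideanSpace ℝ (Fin d)) hr.le
      obtain ⟨y, hy⟩ := hball w hw.le
      refine ⟨y, (congrArg h hy).trans ?_⟩
      rw [hb w (hw ▸ le_max_left _ _), hb z ((le_max_left _ _).trans hz)]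

/-- A connected space locally modelled on a point is a point. -/
lemma ChartedSpace.subsingleton_of_preconnectedSpace (H : Type*) {X : Type*} [TopologicalSpace H]
    [Subsingleton H] [TopologicalSpace X] [ChartedSpace H X] [PreconnectedSpace X] :
    Subsingleton X := by
  have : DiscreteTopology X := by
    refine discreteTopology_iff_isOpen_singleton.2 fun x ↦ ?_
    convert (chartAt H x).open_source
    refine (Set.Subsingleton.eq_singleton_of_mem ?_ (mem_chart_source H x)).symm
    exact fun y hy z hz ↦ (chartAt H x).injOn hy hz (Subsingleton.elim _ _)
  exact PreconnectedSpace.trivial_of_discrete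

/-- `M ⊆ ℝ^p` carries, on its subspace topology, the structure of a smooth `d`-manifold without
boundary for which the inclusion into `ℝ^p` is a smooth embedding. -/
theorem mainTheorem2 (d p : ℕ) (hdp : d ≤ p)
    (M : Set (EuclideanSpace ℝ (Fin p)))
    [ChartedSpace (EuclideanSpace ℝ (Fin d)) M] [IsManifold (𝓡 d) ∞ M]
    (hemb : Manifold.IsSmoothEmbedding (𝓡 d) (𝓡 p) ∞
      (Subtype.val : M → EuclideanSpace ℝ (Fin p)))
    (hcompact : IsCompact M) (hconn : IsConnected M) :
    ∃ f : Metric.sphere (0 : EuclideanSpace ℝ (Fin (d + 1))) 1 → EuclideanSpace ℝ (Fin p),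
      ContMDiff (𝓡 d) (𝓡 p) ∞ f ∧ Set.range f = M := by
  -- For `d = 0` the model space has no nonzero vectors, so gluing by translation is unavailable;
  -- `M` is then a point.
  rcases Nat.eq_zero_or_pos d with rfl | hd
  · have := isPreconnected_iff_preconnectedSpace.1 hconn.isPreconnected
    have := ChartedSpace.subsingleton_of_preconnectedSpace (EuclideanSpace ℝ (Fin 0)) (X := M)
    obtain ⟨b, hb⟩ := hconn.nonempty
    have hM : M = {b} := (Set.subsingleton_coe M |>.1 this).eq_singleton_of_mem hb
    have : Nonempty (Metric.sphere (0 : EuclideanSpace ℝ (Fin (0 + 1))) 1) :=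
      (NormedSpace.sphere_nonempty.2 zero_le_one).to_subtype
    exact ⟨fun _ ↦ b, contMDiff_const, by rw [Set.range_const, hM]⟩
  · have : NeZero d := ⟨hd.ne'⟩
    obtain ⟨b, h, hs, hM, hr, R, -, hb⟩ := CoveredFrom.of_isCompact_of_isConnected
      (E := EuclideanSpace ℝ (Fin d)) hcompact hconn fun b hb ↦
        exists_contDiff_range_mem_nhdsWithin hemb.contMDiff hb
    obtain ⟨f, hf, hfr⟩ := exists_contMDiff_sphere_range_eq hs hb
    exact ⟨f, hf, hfr.trans ((Set.range_subset_iff.2 hM).antisymm hr)⟩
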